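/- Let $\mathbf k$ be a field, let $X$ be a smooth toric variety with Cox ring $S=\mathbf k[x_1,\dots,x_n]$ and irrelevant ideal $B$, and use the fine $\mathbb Z^n$-grading on $S$. All simplicial complexes are finite and contain the empty simplex $\emptyset$ (of dimension $-1$) as soon as they are non-empty. A labeled simplicial complex $(\Delta,\ell)$ is a simplicial complex $\Delta$ with a monomial $\ell(\sigma)\in S$ for each $\sigma\in\Delta$ such that $\ell(\tau)\mid\ell(\sigma)$ whenever $\tau\subseteq\sigma$. It is lcm-labeled if $\ell(\emptyset)=1$ and $\ell(\sigma)=\operatorname{lcm}\{\ell(\tau):\tau\subsetneq\sigma\}$ for every $\sigma\in\Delta$ with at least two vertices. For a monomial $m$ put $\Delta_m=\{\sigma\in\Delta:\ell(\sigma)\mid m\}$, and for a vertex $v$ write $\ell(v)=\ell(\{v\})$. Let $F_\Delta$ be the complex of graded free $S$-modules with $F_{\Delta,i}=\bigoplus_{\dim\sigma=i-1}S(-\deg\ell(\sigma))$ and $\partial[\sigma]=\sum_{\tau}\pm\frac{\ell(\sigma)}{\ell(\tau)}[\tau]$, the sum being over the codimension-one faces $\tau$ of $\sigma$ with the usual simplicial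 signs. It is a virtual resolution if the associated complex of sheaves $F_\Delta^{\sim}$ on $X$ is exact in all positive homological degrees. Let $(\Delta,\ell)$ be an lcm-labeled simplicial complex such that $F_\Delta$ is a virtual resolution, let $\omega\in\Delta$ be a non-empty simplex with vertices $v_0,\dots,v_r$, and let $v'$ be a new vertex. Let $$\Delta'=\left(\Delta\setminus\{\sigma\in\Delta:\omega\subseteq\sigma\}\right)\cup\{\sigma\cup\{v'\}:\sigma\cup\omega\in\Delta,\ \omega\not\subseteq\sigma\}$$ be the stellar subdivision of $\Delta$ at a point $v'$ in $\omega$, and let $\ell'$ be an lcm-labeling of $\Delta'$ with $\ell'=\ell$ on $\Delta\cap\Delta'$. Assume that the subdivision is virtual compatible, that is, $\ell'(v')\mid\ell(\omega)$ and $\ell'(v')\in\langle\ell(v_0),\dots,\ell(v_r)\rangle:B^\infty$. Write $\Gamma=\operatorname{link}_\omega(\Delta)=\{\sigma\in\Delta:\sigma\cap\omega=\emptyset,\ \sigma\cup\omega\in\Delta\}$, labeled by $\ell$. Suppose that for every monomial $m\in S$ such that $\ell'(v')\mid m$ and $\ell(v)\nmid m$ for all $v\in\omega$, the map $\widetilde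 H_j(\Gamma_m;\mathbf k)\to\widetilde H_j(\Delta_m;\mathbf k)$ induced by the inclusion is injective for all $j\ge-1$. Then for all $i\ge0$ and $\alpha\in\mathbb Z^n$ $$\dim_{\mathbf k} H_i(F_{\Delta'})_\alpha\le\dim_{\mathbf k} H_i(F_\Delta)_\alpha.$$ Moreover, the inequality is strict for all $i\ge0$ and $\alpha$ such that $m=x^\alpha$ is a monomial of $S$ with $\ell'(v')\mid m$, $\ell(v)\nmid m$ for all $v\in\omega$, and $\widetilde H_{i-1}(\Gamma_m;\mathbf k)\ne0$. -/

import Mathlib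

open MvPolynomial

noncomputable section

namespace VirtualSubdivision

/-! ### Smooth toric varieties, given by smooth fans -/

/-- The cone in `ℝ^r` generated by the vectors `u ρ`, for `ρ ∈ σ`. -/
def realCone {r n : ℕ} (u : Fin n → Fin r → ℤ) (σ : Finset (Fin n)) : Set (Fin r → ℝ) :=
  {x | ∃ c : Fin n → ℝ, (∀ ρ, 0 ≤ c ρ) ∧ x = ∑ ρ ∈ σ, c ρ • (fun j => (u ρ j : ℝ))}

/-- A smooth fan in the lattice `N = ℤ^r` with `n` rays; smooth toric varieties are the varieties
of such fans. Every cone of a smooth fan is simplicial, so it is recorded by its set of rays, and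
its faces are given by the subsets of that set. -/
structure SmoothFan (r n : ℕ) where
  /-- the primitive generators of the rays -/
  ray : Fin n → Fin r → ℤ
  /-- the cones, each one given by its set of rays -/
  cones : Finset (Finset (Fin n))
  /-- the cone `{0}` belongs to the fan -/
  empty_mem : ∅ ∈ cones
  /-- every ray is a cone of the fan -/
  ray_mem : ∀ ρ, {ρ} ∈ cones
  /-- a face of a cone is a cone -/
  down_closed : ∀ σ ∈ cones, ∀ τ, τ ⊆ σ → τ ∈ cones
  /-- the ray generators of each cone are part of a `ℤ`-basis of `N` -/
  smooth : ∀ σ ∈ cones, ∃ (b : Module.Basis (Fin r) ℤ (Fin r → ℤ)) (e : Fin n → Fin r),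
    Set.InjOn e (σ : Set (Fin n)) ∧ ∀ ρ ∈ σ, ray ρ = b (e ρ)
  /-- two cones intersect in a common face -/
  inter : ∀ σ ∈ cones, ∀ τ ∈ cones,
    realCone ray σ ∩ realCone ray τ = realCone ray (σ ∩ τ)

/-- The Cox ring `S = k[x_1, …, x_n]`, with one variable for each ray. -/
abbrev Cox (k : Type*) [Field k] (n : ℕ) := MvPolynomial (Fin n) k

/-- The map from the character lattice `M = ℤ^r` to torus-invariant divisors,
`m ↦ (⟨m, u_ρ⟩)_ρ`. -/
def SmoothFan.divMap {r n : ℕ} (X : SmoothFan r n) : (Fin r → ℤ) →+ (Fin n → ℤ) where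
  toFun m := fun ρ => ∑ j, m j * X.ray ρ j
  map_zero' := by
    funext ρ
    simp
  map_add' a b := by
    funext ρ
    simp [add_mul, Finset.sum_add_distrib]

/-- The class group `Cl(X) = ℤ^n / M`. -/
abbrev SmoothFan.Cl {r n : ℕ} (X : SmoothFan r n) : Type := (Fin n → ℤ) ⧸ X.divMap.range

/-- The class in `Cl(X)` of a fine degree in `ℤ^n`. -/
def SmoothFan.clClass {r n : ℕ} (X : SmoothFan r n) (a : Fin n → ℤ) : X.Cl :=
  QuotientAddGroup.mk a

/-- An exponent vector, seen as a fine degree in `ℤ^n`. -/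
def toDeg {n : ℕ} (m : Fin n →₀ ℕ) : Fin n → ℤ := fun ρ => (m ρ : ℤ)

/-- The exponent vector of `x^σ̂ = ∏_{ρ ∉ σ} x_ρ`. -/
def hatExp {n : ℕ} (σ : Finset (Fin n)) : Fin n →₀ ℕ := ∑ ρ ∈ σᶜ, Finsupp.single ρ 1

/-- The monomial `x^σ̂ = ∏_{ρ ∉ σ} x_ρ`. -/
def hatMonomial (k : Type*) [Field k] {n : ℕ} (σ : Finset (Fin n)) : Cox k n :=
  monomial (hatExp σ) 1

/-- The irrelevant ideal `B`, generated by the monomials `x^σ̂` for the cones `σ`. -/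
def SmoothFan.irrelevantIdeal {r n : ℕ} (X : SmoothFan r n) (k : Type*) [Field k] :
    Ideal (Cox k n) :=
  Ideal.span {f | ∃ σ ∈ X.cones, f = hatMonomial k σ}

/-- The saturation `I : B^∞`, the union of the increasing chain of ideals `I : B^d`. -/
def saturation {R : Type*} [CommRing R] (I B : Ideal R) : Ideal R :=
  ⨆ d : ℕ, Submodule.colon I ((B ^ d : Ideal R) : Set R)

/-! ### Simplicial complexes -/

/-- A (finite, abstract) simplicial complex. The empty simplex is a face of every complex that
has a face at all. -/
structure SComplex (V : Type*) where
  faces : Finset (Finset V)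
  down_closed : ∀ σ ∈ faces, ∀ τ, τ ⊆ σ → τ ∈ faces

/-- A complex whose simplices are labeled by monomials of `k[x_1, …, x_n]`, each one given by its
exponent vector (so that divisibility of labels is `≤` and their lcm is `⊔`). Only the labels of
faces are meaningful. -/
structure LComplex (V : Type*) (n : ℕ) extends SComplex V where
  label : Finset V → Fin n →₀ ℕ
  label_mono : ∀ σ ∈ faces, ∀ τ, τ ⊆ σ → label τ ≤ label σ

/-- An lcm-labeling: the empty simplex has label `1`, and the label of a simplex of positive
dimension is the lcm of the labels of its proper faces. (The labels of vertices are free.) -/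
def LComplex.IsLcm {V : Type*} [DecidableEq V] {n : ℕ} (Δ : LComplex V n) : Prop :=
  (∅ ∈ Δ.faces → Δ.label ∅ = 0) ∧
    ∀ σ ∈ Δ.faces, 2 ≤ σ.card → Δ.label σ = σ.ssubsets.sup Δ.label

/-- The subcomplex `Δ_m` of the simplices whose label divides `m`. -/
def LComplex.sub {V : Type*} {n : ℕ} (Δ : LComplex V n) (m : Fin n →₀ ℕ) : SComplex V where
  faces := by
    classical exact Δ.faces.filter fun σ => Δ.label σ ≤ m
  down_closed := by
    classical
    intro σ hσ τ hτ
    rw [Finset.mem_filter] at hσ ⊢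
    exact ⟨Δ.down_closed σ hσ.1 τ hτ, (Δ.label_mono σ hσ.1 τ hτ).trans hσ.2⟩

/-- The link of `ω` in `Δ`, with the labels of `Δ`. -/
def LComplex.link {V : Type*} [DecidableEq V] {n : ℕ} (Δ : LComplex V n) (ω : Finset V) :
    LComplex V n where
  faces := Δ.faces.filter fun σ => Disjoint ω σ ∧ ω ∪ σ ∈ Δ.faces
  down_closed := by
    intro σ hσ τ hτ
    rw [Finset.mem_filter] at hσ ⊢
    exact ⟨Δ.down_closed σ hσ.1 τ hτ, hσ.2.1.mono_right hτ,
      Δ.down_closed _ hσ.2.2 _ (Finset.union_subset_union_right hτ)⟩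
  label := Δ.label
  label_mono := fun σ hσ => Δ.label_mono σ (Finset.mem_filter.mp hσ).1

/-- The stellar subdivision of `Δ` at a point `v'` in the simplex `ω`:
`(Δ \ {σ ∈ Δ : ω ⊆ σ}) ∪ {σ ∪ {v'} : σ ∪ ω ∈ Δ, ω ⊈ σ}`. (If `σ ∪ ω ∈ Δ` then `σ ∈ Δ`.) -/
def SComplex.subdivide {V : Type*} [DecidableEq V] (Δ : SComplex V) (ω : Finset V) (v' : V) :
    SComplex V where
  faces := (Δ.faces.filter fun σ => ¬ ω ⊆ σ) ∪
    (Δ.faces.filter fun σ => σ ∪ ω ∈ Δ.faces ∧ ¬ ω ⊆ σ).image fun σ => σ ∪ {v'}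
  down_closed := by
    intro σ hσ τ hτ
    simp only [Finset.mem_union, Finset.mem_filter, Finset.mem_image] at hσ ⊢
    rcases hσ with ⟨h1, h2⟩ | ⟨ρ, ⟨h1, h2, h3⟩, rfl⟩
    · exact Or.inl ⟨Δ.down_closed σ h1 τ hτ, fun h => h2 (h.trans hτ)⟩
    · by_cases hv : v' ∈ τ
      · have hsub : τ.erase v' ⊆ ρ := by
          intro x hx
          have h4 := hτ (Finset.mem_of_mem_erase hx)
          rcases Finset.mem_union.mp h4 with h | h
          · exact h
          · exact absurd (Finset.mem_singleton.mp h) (Finset.ne_of_mem_erase hx)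
        refine Or.inr ⟨τ.erase v', ⟨Δ.down_closed ρ h1 _ hsub,
          Δ.down_closed _ h2 _ (Finset.union_subset_union_left hsub),
          fun h => h3 (h.trans hsub)⟩, ?_⟩
        rw [Finset.union_comm, ← Finset.insert_eq, Finset.insert_erase hv]
      · have hsub : τ ⊆ ρ := by
          intro x hx
          rcases Finset.mem_union.mp (hτ hx) with h | h
          · exact h
          · exact absurd (Finset.mem_singleton.mp h ▸ hx) hv
        exact Or.inl ⟨Δ.down_closed ρ h1 τ hsub, fun h => h3 (h.trans hsub)⟩

/-- `(Δ', ℓ')` is a subdivision of `(Δ, ℓ)` at a point `v'` in the simplex `ω`: the complex `Δ'` is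
the stellar subdivision by the single new vertex `v'`, and `ℓ' = ℓ` on `Δ ∩ Δ'`. -/
structure IsSubdivision {V : Type*} [DecidableEq V] {n : ℕ} (Δ Δ' : LComplex V n)
    (ω : Finset V) (v' : V) : Prop where
  mem : ω ∈ Δ.faces
  nonempty : ω.Nonempty
  new : {v'} ∉ Δ.faces
  eq : Δ'.toSComplex = Δ.toSComplex.subdivide ω v'
  label_eq : ∀ σ ∈ Δ.faces, σ ∈ Δ'.faces → Δ'.label σ = Δ.label σ

/-- A virtual compatible subdivision: `ℓ'(v')` divides `ℓ(ω)`, and `ℓ'(v')` lies in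
`⟨ℓ(v_0), …, ℓ(v_r)⟩ : B^∞`, where `v_0, …, v_r` are the vertices of `ω`. -/
structure IsVirtualCompatible (k : Type*) [Field k] {r n : ℕ} (X : SmoothFan r n)
    {V : Type*} [DecidableEq V] (Δ Δ' : LComplex V n) (ω : Finset V) (v' : V) : Prop
    extends IsSubdivision Δ Δ' ω v' where
  dvd : Δ'.label {v'} ≤ Δ.label ω
  mem_saturation : (monomial (Δ'.label {v'}) 1 : Cox k n) ∈
    saturation (Ideal.span {f | ∃ v ∈ ω, f = monomial (Δ.label {v}) 1})
      (X.irrelevantIdeal k)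

/-! ### Chain complexes and homology -/

section Homology

variable {R M : Type*} [CommRing R] [AddCommGroup M] [Module R M]

/-- The cycles in degree `i` of the complex `⋯ → C 2 → C 1 → C 0 → 0`, whose terms are submodules
of one module `M` and whose differential is the restriction of `d`. -/
def cycles (C : ℕ → Submodule R M) (d : M →ₗ[R] M) (i : ℕ) : Submodule R M :=
  C i ⊓ LinearMap.ker d

/-- The boundaries in degree `i`. -/
def boundaries (C : ℕ → Submodule R M) (d : M →ₗ[R] M) (i : ℕ) : Submodule R M :=
  (C (i + 1)).map d

/-- The homology in degree `i`: cycles modulo boundaries. -/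
abbrev Homology (C : ℕ → Submodule R M) (d : M →ₗ[R] M) (i : ℕ) : Type _ :=
  cycles C d i ⧸ (boundaries C d i).submoduleOf (cycles C d i)

/-- The map in homology induced by the inclusion of a subcomplex. -/
def homologyMap {C C' : ℕ → Submodule R M} (h : ∀ j, C j ≤ C' j) (d : M →ₗ[R] M) (i : ℕ) :
    Homology C d i →ₗ[R] Homology C' d i :=
  Submodule.mapQ _ _ (Submodule.inclusion (inf_le_inf_right _ (h i)))
    fun _ hx => Submodule.map_mono (h (i + 1)) hx

/-- The homology classes of the cycles that lie in the `k`-subspace `P`. -/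
def homologyPart {k : Type*} [Field k] [Algebra k R] [Module k M] [IsScalarTower k R M]
    (C : ℕ → Submodule R M) (d : M →ₗ[R] M) (P : Submodule k M) (i : ℕ) :
    Submodule k (Homology C d i) :=
  (P.comap ((cycles C d i).subtype.restrictScalars k)).map
    ((Submodule.mkQ ((boundaries C d i).submoduleOf (cycles C d i))).restrictScalars k)

end Homology

/-- The boundary map with coefficients `c`:
`[σ] ↦ ∑_{v ∈ σ} (-1)^{position of v in σ} c(σ, σ \ v) [σ \ v]`. -/
def boundary {R : Type*} [CommRing R] {V : Type*} [LinearOrder V] (c : Finset V → Finset V → R) :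
    (Finset V →₀ R) →ₗ[R] (Finset V →₀ R) :=
  Finsupp.linearCombination R fun σ => ∑ v ∈ σ,
    Finsupp.single (σ.erase v) ((-1) ^ (σ.filter fun u => u < v).card * c σ (σ.erase v))

/-- The free module on the simplices of `K` with `i` vertices, that is, of dimension `i - 1`. -/
def chains (R : Type*) [CommRing R] {V : Type*} (K : SComplex V) (i : ℕ) :
    Submodule R (Finset V →₀ R) :=
  Finsupp.supported R R {σ | σ ∈ K.faces ∧ σ.card = i}

/-- An inclusion of complexes induces an inclusion of chains. -/
theorem chains_mono (R : Type*) [CommRing R] {V : Type*} {K L : SComplex V}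
    (h : K.faces ⊆ L.faces) (i : ℕ) : chains R K i ≤ chains R L i :=
  Finsupp.supported_mono fun _ hσ => ⟨h hσ.1, hσ.2⟩

/-- The reduced simplicial homology `H̃_{i-1}(K; k)`, for `i = 0, 1, 2, …`. -/
abbrev redHomology (k : Type*) [Field k] {V : Type*} [LinearOrder V] (K : SComplex V) (i : ℕ) :
    Type _ :=
  Homology (chains k K) (boundary fun _ _ => 1) i

/-- The map `H̃_{i-1}(K; k) → H̃_{i-1}(L; k)` induced by an inclusion `K ⊆ L`. -/
def redHomologyMap (k : Type*) [Field k] {V : Type*} [LinearOrder V] {K L : SComplex V}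
    (h : K.faces ⊆ L.faces) (i : ℕ) : redHomology k K i →ₗ[k] redHomology k L i :=
  homologyMap (chains_mono k h) _ i

/-- `Γ_m ⊆ Δ_m`, where `Γ` is a link in `Δ`. -/
theorem link_sub_subset {V : Type*} [DecidableEq V] {n : ℕ} (Δ : LComplex V n) (ω : Finset V)
    (m : Fin n →₀ ℕ) : ((Δ.link ω).sub m).faces ⊆ (Δ.sub m).faces := by
  classical
  intro σ hσ
  have h := Finset.mem_filter.mp hσ
  exact Finset.mem_filter.mpr ⟨(Finset.mem_filter.mp h.1).1, h.2⟩

/-! ### The free complex of a labeled complex -/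

section FreeComplex

variable (k : Type*) [Field k] {V : Type*} [LinearOrder V] {n : ℕ}

/-- The coefficient `ℓ(σ) / ℓ(τ)` in the differential of `F_Δ`. -/
def labelQuot (Δ : LComplex V n) (σ τ : Finset V) : Cox k n :=
  monomial (Δ.label σ - Δ.label τ) 1

/-- The homology module `H_i(F_Δ)`. The term of `F_Δ` in degree `i` is the free `S`-module
on the simplices with `i` vertices, with differential
`[σ] ↦ ∑ ± (ℓ(σ) / ℓ(τ)) [τ]`. -/
abbrev freeHomology (Δ : LComplex V n) (i : ℕ) : Type _ :=
  Homology (chains (Cox k n) Δ.toSComplex) (boundary (labelQuot k Δ)) i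

/-- The elements of fine degree `α ∈ ℤ^n`, where `[σ]` has the degree of `ℓ(σ)`. -/
def gradedPart (Δ : LComplex V n) (α : Fin n → ℤ) : Submodule k (Finset V →₀ Cox k n) where
  carrier := {f | ∀ σ, ∀ m ∈ (f σ).support, toDeg m + toDeg (Δ.label σ) = α}
  zero_mem' := by
    intro σ m hm
    simp at hm
  add_mem' := by
    intro f g hf hg σ m hm
    rw [Finsupp.add_apply] at hm
    rcases Finset.mem_union.mp (MvPolynomial.support_add hm) with h | h
    · exact hf σ m h
    · exact hg σ m h
  smul_mem' := by
    intro a f hf σ m hm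
    exact hf σ m (MvPolynomial.support_smul hm)

/-- The graded piece `H_i(F_Δ)_α`: the homology classes of the cycles of degree `α`. -/
def freeHomologyDeg (Δ : LComplex V n) (i : ℕ) (α : Fin n → ℤ) :
    Submodule k (freeHomology k Δ i) :=
  homologyPart (chains (Cox k n) Δ.toSComplex) (boundary (labelQuot k Δ)) (gradedPart k Δ α) i

/-- The elements of the free module on all simplices that are homogeneous of degree `a ∈ Cl(X)`. -/
def IsClHomogeneous {r : ℕ} (X : SmoothFan r n) (Δ : LComplex V n) (a : X.Cl)
    (f : Finset V →₀ Cox k n) : Prop :=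
  ∀ σ, ∀ m ∈ (f σ).support, X.clClass (toDeg m + toDeg (Δ.label σ)) = a

/-- The sections of the sheaf `F_i^~` on the affine chart of the cone `σ`: the part of
`Cl(X)`-degree `0` of the localization of `F_i` at `x^σ̂`, consisting of the fractions
`f / (x^σ̂)^t` with `f` homogeneous of the degree of `(x^σ̂)^t`. -/
def chartSections {r : ℕ} (X : SmoothFan r n) (Δ : LComplex V n) (σ : Finset (Fin n)) (i : ℕ) :
    Set (LocalizedModule (Submonoid.powers (hatMonomial k σ)) (Finset V →₀ Cox k n)) :=
  {y | ∃ f ∈ chains (Cox k n) Δ.toSComplex i, ∃ t : ℕ,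
    IsClHomogeneous k X Δ (t • X.clClass (toDeg (hatExp σ))) f ∧
    y = LocalizedModule.mk f ⟨hatMonomial k σ ^ t, pow_mem (Submonoid.mem_powers _) t⟩}

/-- The differential on the localization at `x^σ̂`. -/
def chartBoundary (Δ : LComplex V n) (σ : Finset (Fin n)) :
    LocalizedModule (Submonoid.powers (hatMonomial k σ)) (Finset V →₀ Cox k n) →ₗ[Cox k n]
      LocalizedModule (Submonoid.powers (hatMonomial k σ)) (Finset V →₀ Cox k n) :=
  IsLocalizedModule.map (Submonoid.powers (hatMonomial k σ))
    (LocalizedModule.mkLinearMap (Submonoid.powers (hatMonomial k σ)) (Finset V →₀ Cox k n))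
    (LocalizedModule.mkLinearMap (Submonoid.powers (hatMonomial k σ)) (Finset V →₀ Cox k n))
    (boundary (labelQuot k Δ))

/-- `F_Δ` is a virtual resolution (of its `H_0`): the complex of sheaves `F_Δ^~` on the toric
variety of `X` is exact in all positive homological degrees. These sheaves are quasi-coherent, so
this is exactness of the sections on each affine chart of the variety. -/
def IsVirtualResolution {r : ℕ} (X : SmoothFan r n) (Δ : LComplex V n) : Prop :=
  ∀ i : ℕ, 0 < i → ∀ σ ∈ X.cones, ∀ y ∈ chartSections k X Δ σ i,
    chartBoundary k Δ σ y = 0 → ∃ z ∈ chartSections k X Δ σ (i + 1), chartBoundary k Δ σ z = y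

end FreeComplex

end VirtualSubdivision

end

open VirtualSubdivision

open VirtualSubdivision

namespace VirtualSubdivision

/-! ### Chains supported on sets of simplices -/

section Supported

variable {k : Type*} [Field k] {V : Type*}

/-! The fine grading reduces everything to simplicial homology: `H_i(F_Δ)` in degree `toDeg m` is
`H̃_{i-1}(Δ_m)` (`rank_freeHomologyDeg`), and it vanishes in all other degrees. It remains to
compare `Δ_m` with `Δ'_m` for each monomial `m`.

If `ℓ'(v')` does not divide `m`, the two complexes coincide. If it does and some vertex `w` of `ω`
also has a label dividing `m`, both include into `Δ_m` with a cone from `v'` over the star of `ω`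
added; simplices are paired off by adding or removing `w` in one case and `v'` in the other, so both
inclusions are isomorphisms in homology (`rank_setHomology_eq`). Otherwise no vertex of `ω` occurs
in `Δ_m`, and `Δ'_m` is `Δ_m` with a cone over `Γ_m` attached. As `H̃(Γ_m) → H̃(Δ_m)` is injective,
attaching the cone creates no new class (`setHomologyMap_surjective_of_cone`) and kills the image of
`H̃(Γ_m)` (`not_injective_setHomologyMap_of_cone`). This gives the inequality and its strictness.

Exact sequences are replaced by the homotopy formula `boundary_coneMap_add`, applied to chains on
arbitrary sets of simplices. -/

theorem mem_supported_inter {s t : Set (Finset V)} {x : Finset V →₀ k}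
    (hs : x ∈ Finsupp.supported k k s) (ht : x ∈ Finsupp.supported k k t) :
    x ∈ Finsupp.supported k k (s ∩ t) := by
  rw [Finsupp.supported_inter]; exact ⟨hs, ht⟩

/-- A chain is the sum of a chain on `t` and a chain outside of `t`. -/
theorem exists_add_eq_of_mem_supported {s : Set (Finset V)} {x : Finset V →₀ k}
    (hx : x ∈ Finsupp.supported k k s) (t : Set (Finset V)) :
    ∃ a ∈ Finsupp.supported k k (s ∩ t), ∃ b ∈ Finsupp.supported k k (s \ t), a + b = x := by
  have : x ∈ Finsupp.supported k k (s ∩ t) ⊔ Finsupp.supported k k (s \ t) := by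
    rwa [← Finsupp.supported_union, Set.inter_union_sdiff]
  exact Submodule.mem_sup.mp this

/-- The chains on the simplices with `i` vertices that belong to `s`. -/
abbrev setChains (k : Type*) [Field k] {V : Type*} (s : Set (Finset V)) (i : ℕ) :
    Submodule k (Finset V →₀ k) :=
  Finsupp.supported k k {σ | σ ∈ s ∧ σ.card = i}

theorem setChains_mono {s t : Set (Finset V)} (h : s ⊆ t) (i : ℕ) :
    setChains k s i ≤ setChains k t i :=
  Finsupp.supported_mono fun _ hσ => ⟨h hσ.1, hσ.2⟩

end Supported

/-! ### The simplicial boundary and the cone homotopy -/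

section Cone

variable {k : Type*} [Field k] {V : Type*} [LinearOrder V]

/-- The number of vertices of `σ` that precede `v`. -/
def position (σ : Finset V) (v : V) : ℕ := (σ.filter fun u => u < v).card

theorem position_erase_self (σ : Finset V) (v : V) : position (σ.erase v) v = position σ v := by
  unfold position
  rw [Finset.filter_erase, Finset.erase_eq_of_notMem (by simp)]

theorem position_insert_self (σ : Finset V) (v : V) : position (insert v σ) v = position σ v := by
  unfold position
  rw [Finset.filter_insert, if_neg (lt_irrefl v)]

theorem position_insert {σ : Finset V} {v w : V} (hw : w ∉ σ) :
    position (insert w σ) v = position σ v + if w < v then 1 else 0 := by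
  unfold position
  rw [Finset.filter_insert]
  split_ifs with h
  · rw [Finset.card_insert_of_notMem (by simp [hw])]
  · rfl

theorem position_erase {σ : Finset V} {v w : V} (hv : v ∈ σ) :
    position σ w = position (σ.erase v) w + if v < w then 1 else 0 := by
  conv_lhs => rw [← Finset.insert_erase hv]
  exact position_insert (Finset.notMem_erase v σ)

/-- The boundary map of the simplicial chain complex of all finite subsets of `V`. -/
noncomputable abbrev simplicialBoundary (k : Type*) [Field k] (V : Type*) [LinearOrder V] :
    (Finset V →₀ k) →ₗ[k] (Finset V →₀ k) :=
  boundary fun _ _ => 1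

/-- The cone operator with apex `w`: it joins a simplex with the vertex `w`. -/
noncomputable def coneMap (k : Type*) [Field k] {V : Type*} [LinearOrder V] (w : V) :
    (Finset V →₀ k) →ₗ[k] (Finset V →₀ k) :=
  Finsupp.linearCombination k fun σ =>
    if w ∈ σ then 0 else Finsupp.single (insert w σ) ((-1) ^ position σ w)

theorem boundary_single {R : Type*} [CommRing R] (c : Finset V → Finset V → R) (σ : Finset V)
    (a : R) : boundary c (Finsupp.single σ a) = ∑ v ∈ σ,
      Finsupp.single (σ.erase v) (a * ((-1) ^ position σ v * c σ (σ.erase v))) := by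
  rw [boundary, Finsupp.linearCombination_single, Finset.smul_sum]
  exact Finset.sum_congr rfl fun v _ => by rw [Finsupp.smul_single, smul_eq_mul, position]

theorem coneMap_single_of_mem {w : V} {σ : Finset V} (h : w ∈ σ) (a : k) :
    coneMap k w (Finsupp.single σ a) = 0 := by
  simp [coneMap, Finsupp.linearCombination_single, h]

theorem coneMap_single_of_notMem {w : V} {σ : Finset V} (h : w ∉ σ) (a : k) :
    coneMap k w (Finsupp.single σ a) =
      Finsupp.single (insert w σ) (a * (-1) ^ position σ w) := by
  simp [coneMap, Finsupp.linearCombination_single, h]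

theorem neg_one_pow_mul_self (p : ℕ) : ((-1 : k) ^ p * (-1) ^ p) = 1 := by
  rw [← mul_pow]; simp

/-- The cone operator is a contracting homotopy. -/
theorem boundary_coneMap_add (w : V) (x : Finset V →₀ k) :
    simplicialBoundary k V (coneMap k w x) + coneMap k w (simplicialBoundary k V x) = x := by
  induction x using Finsupp.induction_linear with
  | zero => simp
  | add f g hf hg =>
    simp only [map_add]
    rw [add_add_add_comm, hf, hg]
  | single σ a =>
    by_cases hw : w ∈ σ
    · rw [coneMap_single_of_mem hw, map_zero, zero_add, boundary_single, map_sum,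
        Finset.sum_eq_single_of_mem w hw]
      · rw [coneMap_single_of_notMem (Finset.notMem_erase w σ), Finset.insert_erase hw,
          position_erase_self, mul_one, mul_assoc, neg_one_pow_mul_self, mul_one]
      · intro v _ hv
        exact coneMap_single_of_mem (Finset.mem_erase.mpr ⟨hv.symm, hw⟩) _
    · rw [coneMap_single_of_notMem hw, boundary_single, boundary_single, map_sum,
        Finset.sum_insert hw, Finset.erase_insert hw, position_insert_self, add_assoc,
        ← Finset.sum_add_distrib, Finset.sum_eq_zero, add_zero, mul_one, mul_assoc,
        neg_one_pow_mul_self, mul_one]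
      intro v hv
      have hne : v ≠ w := fun h => hw (h ▸ hv)
      rw [coneMap_single_of_notMem fun h => hw (Finset.mem_of_mem_erase h),
        Finset.erase_insert_of_ne hne.symm, ← Finsupp.single_add, position_insert hw,
        position_erase (w := w) hv, Finsupp.single_eq_zero]
      -- Exactly one of the two positions shifts by one, so the two terms have opposite signs.
      rcases lt_or_gt_of_ne hne with h | h
      · rw [if_pos h, if_neg h.not_gt]
        ring
      · rw [if_neg h.not_gt, if_pos h]
        ring

/-- Comparing the boundary of the homotopy formula at `y` with the formula at the boundary of `y`
shows that `∂∂` commutes with every cone operator. Up to sign each non-empty simplex is a cone over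
a smaller one, so induction on vertices applies. -/
theorem boundary_boundary (x : Finset V →₀ k) :
    simplicialBoundary k V (simplicialBoundary k V x) = 0 := by
  have key : ∀ (w : V) (y : Finset V →₀ k),
      simplicialBoundary k V (simplicialBoundary k V (coneMap k w y)) =
        coneMap k w (simplicialBoundary k V (simplicialBoundary k V y)) := by
    intro w y
    have h1 := congrArg (simplicialBoundary k V) (boundary_coneMap_add w y)
    have h2 := boundary_coneMap_add w (simplicialBoundary k V y)
    rw [map_add] at h1
    exact add_left_cancel ((add_comm _ _).trans (h1.trans h2.symm))
  induction x using Finsupp.induction_linear with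
  | zero => simp
  | add f g hf hg => rw [map_add, map_add, hf, hg, add_zero]
  | single σ a =>
    induction σ using Finset.induction_on generalizing a with
    | empty => rw [boundary_single]; simp
    | insert w σ hw ih =>
      have h : Finsupp.single (insert w σ) a =
          coneMap k w (Finsupp.single σ (a * (-1) ^ position σ w)) := by
        rw [coneMap_single_of_notMem hw, mul_assoc, neg_one_pow_mul_self, mul_one]
      rw [h, key, ih, map_zero]

theorem boundary_mem_supported {s t : Set (Finset V)} {x : Finset V →₀ k}
    (hx : x ∈ Finsupp.supported k k s) (h : ∀ σ ∈ s, ∀ v ∈ σ, σ.erase v ∈ t) :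
    simplicialBoundary k V x ∈ Finsupp.supported k k t := by
  rw [simplicialBoundary, boundary, Finsupp.linearCombination_apply]
  refine Submodule.sum_mem _ fun σ hσ => Submodule.smul_mem _ _ (Submodule.sum_mem _ fun v hv => ?_)
  exact Finsupp.single_mem_supported _ _ (h σ ((Finsupp.mem_supported _ _).mp hx hσ) v hv)

theorem coneMap_mem_supported {w : V} {s t : Set (Finset V)} {x : Finset V →₀ k}
    (hx : x ∈ Finsupp.supported k k s) (h : ∀ σ ∈ s, w ∉ σ → insert w σ ∈ t) :
    coneMap k w x ∈ Finsupp.supported k k t := by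
  rw [coneMap, Finsupp.linearCombination_apply]
  refine Submodule.sum_mem _ fun σ hσ => Submodule.smul_mem _ _ ?_
  split_ifs with hw
  · exact Submodule.zero_mem _
  · exact Finsupp.single_mem_supported _ _ (h σ ((Finsupp.mem_supported _ _).mp hx hσ) hw)

theorem coneMap_eq_zero {w : V} {s : Set (Finset V)} {x : Finset V →₀ k}
    (hx : x ∈ Finsupp.supported k k s) (h : ∀ σ ∈ s, w ∈ σ) : coneMap k w x = 0 := by
  have := coneMap_mem_supported (t := ∅) hx fun σ hσ hw => absurd (h σ hσ) hw
  simpa using this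

end Cone

/-! ### Comparing the homology of two sets of simplices -/

section Sets

variable {k : Type*} [Field k] {V : Type*} [LinearOrder V]

/-- The homology of the chain complex on a set of simplices. -/
abbrev setHomology (k : Type*) [Field k] {V : Type*} [LinearOrder V] (s : Set (Finset V)) (i : ℕ) :
    Type _ :=
  Homology (setChains k s) (simplicialBoundary k V) i

/-- The map induced in homology by an inclusion of sets of simplices. -/
noncomputable abbrev setHomologyMap (k : Type*) [Field k] {V : Type*} [LinearOrder V] {s t : Set (Finset V)}
    (h : s ⊆ t) (i : ℕ) : setHomology k s i →ₗ[k] setHomology k t i :=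
  homologyMap (setChains_mono h) _ i

theorem homologyMap_injective_iff {R M : Type*} [CommRing R] [AddCommGroup M] [Module R M]
    {C C' : ℕ → Submodule R M} (h : ∀ j, C j ≤ C' j) (d : M →ₗ[R] M) (i : ℕ) :
    Function.Injective (homologyMap h d i) ↔
      ∀ x ∈ C i, d x = 0 → (∃ y ∈ C' (i + 1), d y = x) → ∃ y ∈ C (i + 1), d y = x := by
  rw [injective_iff_map_eq_zero]
  constructor
  · intro H x hx hdx hy
    have := H (Submodule.Quotient.mk ⟨x, hx, hdx⟩)
      ((Submodule.Quotient.mk_eq_zero _).mpr hy)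
    exact (Submodule.Quotient.mk_eq_zero _).mp this
  · intro H q hq
    obtain ⟨⟨x, hx, hdx⟩, rfl⟩ := Submodule.Quotient.mk_surjective _ q
    exact (Submodule.Quotient.mk_eq_zero _).mpr
      (H x hx hdx ((Submodule.Quotient.mk_eq_zero _).mp hq))

theorem homologyMap_surjective {R M : Type*} [CommRing R] [AddCommGroup M] [Module R M]
    {C C' : ℕ → Submodule R M} (h : ∀ j, C j ≤ C' j) (d : M →ₗ[R] M) (i : ℕ)
    (H : ∀ x ∈ C' i, d x = 0 → ∃ a ∈ C i, d a = 0 ∧ ∃ y ∈ C' (i + 1), x = a + d y) :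
    Function.Surjective (homologyMap h d i) := by
  intro q
  obtain ⟨⟨x, hx, hdx⟩, rfl⟩ := Submodule.Quotient.mk_surjective _ q
  obtain ⟨a, ha, hda, y, hy, rfl⟩ := H x hx hdx
  refine ⟨Submodule.Quotient.mk ⟨a, ha, hda⟩, ?_⟩
  refine (Submodule.Quotient.eq _).mpr ?_
  refine ⟨-y, neg_mem hy, ?_⟩
  change d (-y) = a - (a + d y)
  rw [map_neg, sub_add_cancel_left]

/-- If the simplices of `t` outside of `s` can be paired by adding or removing the vertex `w`,
then a chain on `t` with boundary in `s` is homologous to a chain on `s`. -/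
theorem exists_homologous {s t : Set (Finset V)} (w : V)
    (hcone : ∀ σ ∈ t, σ ∉ s → insert w σ ∈ t)
    (hface : ∀ σ ∈ t, σ ∉ s → ∀ v ∈ σ, σ.erase v ∈ s → insert w (σ.erase v) ∈ s)
    {i : ℕ} {x : Finset V →₀ k} (hx : x ∈ setChains k t i)
    (hclosed : ∀ σ ∈ s, ∀ v ∈ σ, σ.erase v ∈ s)
    (hdx : simplicialBoundary k V x ∈ Finsupp.supported k k s) :
    ∃ a ∈ setChains k s i, ∃ y ∈ setChains k t (i + 1), x = a + simplicialBoundary k V y := by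
  obtain ⟨a, ha, b, hb, rfl⟩ := exists_add_eq_of_mem_supported hx s
  have hda : simplicialBoundary k V a ∈ Finsupp.supported k k s :=
    boundary_mem_supported ha fun σ hσ => hclosed σ hσ.2
  have hdb : simplicialBoundary k V b ∈ Finsupp.supported k k s := by
    rw [map_add] at hdx
    simpa using sub_mem hdx hda
  have hdb' : simplicialBoundary k V b ∈ Finsupp.supported k k
      {τ | ∃ σ ∈ t, σ ∉ s ∧ σ.card = i ∧ ∃ v ∈ σ, τ = σ.erase v} :=
    boundary_mem_supported hb fun σ hσ v hv => ⟨σ, hσ.1.1, hσ.2, hσ.1.2, v, hv, rfl⟩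
  -- The homotopy formula replaces `b`, the part outside `s`, by the cone over its boundary; that
  -- boundary lies on `s`, and by `hface` so does the cone.
  refine ⟨a + coneMap k w (simplicialBoundary k V b), add_mem ?_ ?_, coneMap k w b, ?_, ?_⟩
  · refine Finsupp.supported_mono ?_ ha
    exact fun σ hσ => ⟨hσ.2, hσ.1.2⟩
  · refine coneMap_mem_supported (mem_supported_inter hdb hdb') ?_
    rintro τ ⟨hτ, σ, hσt, hσs, hcard, v, hv, rfl⟩ hw
    refine ⟨hface σ hσt hσs v hv hτ, ?_⟩
    rw [Finset.card_insert_of_notMem hw, Finset.card_erase_add_one hv, hcard]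
  · refine coneMap_mem_supported hb fun σ hσ hw => ⟨hcone σ hσ.1.1 hσ.2, ?_⟩
    rw [Finset.card_insert_of_notMem hw, hσ.1.2]
  · rw [add_assoc, add_comm (coneMap k w _), boundary_coneMap_add]

/-- The inclusion is an isomorphism in homology: `exists_homologous` moves cycles of `t` into `s`,
and also chains of `t` that bound a cycle of `s`, without changing their boundary. -/
theorem rank_setHomology_eq {s t : Set (Finset V)} (hst : s ⊆ t) (w : V)
    (hclosed : ∀ σ ∈ s, ∀ v ∈ σ, σ.erase v ∈ s)
    (hcone : ∀ σ ∈ t, σ ∉ s → insert w σ ∈ t)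
    (hface : ∀ σ ∈ t, σ ∉ s → ∀ v ∈ σ, σ.erase v ∈ s → insert w (σ.erase v) ∈ s) (i : ℕ) :
    Module.rank k (setHomology k s i) = Module.rank k (setHomology k t i) := by
  refine LinearEquiv.rank_eq (LinearEquiv.ofBijective (setHomologyMap k hst i) ⟨?_, ?_⟩)
  · rw [homologyMap_injective_iff]
    rintro x hx - ⟨y, hy, rfl⟩
    obtain ⟨a, ha, z, -, rfl⟩ := exists_homologous w hcone hface hy hclosed
      (Finsupp.supported_mono (fun σ hσ => hσ.1) hx)
    exact ⟨a, ha, by rw [map_add, boundary_boundary, add_zero]⟩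
  · refine homologyMap_surjective _ _ _ fun x hx hdx => ?_
    obtain ⟨a, ha, y, hy, rfl⟩ := exists_homologous w hcone hface hx hclosed
      (hdx ▸ Submodule.zero_mem _)
    refine ⟨a, ha, ?_, y, hy, rfl⟩
    rwa [map_add, boundary_boundary, add_zero] at hdx

/-- Adding a cone with apex `w` over `l ⊆ s` that is injective in homology gives a surjection in
homology. -/
theorem setHomologyMap_surjective_of_cone {l s t : Set (Finset V)} (hls : l ⊆ s) (hst : s ⊆ t)
    (w : V) (hw : ∀ σ ∈ s, w ∉ σ)
    (hclosed : ∀ σ ∈ s, ∀ v ∈ σ, σ.erase v ∈ s)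
    (hl : ∀ σ ∈ l, insert w σ ∈ t)
    (ht : ∀ σ ∈ t, σ ∉ s → w ∈ σ ∧ σ.erase w ∈ l)
    (hinj : ∀ j, Function.Injective (setHomologyMap k hls j)) (i : ℕ) :
    Function.Surjective (setHomologyMap k hst i) := by
  refine homologyMap_surjective _ _ _ fun x hx hdx => ?_
  obtain ⟨a, ha, b, hb, rfl⟩ := exists_add_eq_of_mem_supported hx s
  have ha' : a ∈ setChains k s i := by
    refine Finsupp.supported_mono ?_ ha
    exact fun σ hσ => ⟨hσ.2, hσ.1.2⟩
  -- Degree `0` carries only the empty simplex, which does not contain `w`, so there is no new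
  -- chain. In degree `i + 1` the boundary of the new part is a cycle on `l` in degree `i`.
  rcases i with _ | i
  · have hb0 : b = 0 := by
      have : b ∈ Finsupp.supported k k (∅ : Set (Finset V)) := by
        refine Finsupp.supported_mono (fun σ hσ => ?_) hb
        have h1 := (ht σ hσ.1.1 hσ.2).1
        rw [Finset.card_eq_zero.mp hσ.1.2] at h1
        simp at h1
      simpa using this
    subst hb0
    exact ⟨a, ha', by simpa using hdx, 0, Submodule.zero_mem _, by simp⟩
  · have hsum : simplicialBoundary k V b = -simplicialBoundary k V a := by
      rw [map_add] at hdx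
      exact eq_neg_of_add_eq_zero_right hdx
    have hdb : simplicialBoundary k V b ∈ Finsupp.supported k k s := by
      rw [hsum]
      exact neg_mem (boundary_mem_supported ha fun σ hσ => hclosed σ hσ.2)
    have hdb' : simplicialBoundary k V b ∈ Finsupp.supported k k
        {τ | ∃ σ ∈ t, σ ∉ s ∧ σ.card = i + 1 ∧ ∃ v ∈ σ, τ = σ.erase v} :=
      boundary_mem_supported hb fun σ hσ v hv => ⟨σ, hσ.1.1, hσ.2, hσ.1.2, v, hv, rfl⟩
    have hlink : simplicialBoundary k V b ∈ setChains k l i := by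
      refine Finsupp.supported_mono ?_ (mem_supported_inter hdb hdb')
      -- A simplex outside `s` contains `w`, while simplices of `s` avoid it, so only the face
      -- opposite `w` can lie in `s`.
      rintro τ ⟨hτ, σ, hσt, hσs, hcard, v, hv, rfl⟩
      obtain ⟨h1, h2⟩ := ht σ hσt hσs
      have hvw : v = w := by
        by_contra hne
        exact hw _ hτ (Finset.mem_erase.mpr ⟨Ne.symm hne, h1⟩)
      subst hvw
      exact ⟨h2, by rw [Finset.card_erase_of_mem hv, hcard]; rfl⟩
    -- The boundary of `b` also bounds `-a` on `s`; by injectivity it bounds some `g` on `l`, which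
    -- can replace `b`.
    obtain ⟨g, hg, hgb⟩ := (homologyMap_injective_iff _ _ _).mp (hinj i) _ hlink
      (boundary_boundary b) ⟨-a, neg_mem ha', by rw [map_neg, hsum]⟩
    -- All simplices of `b` contain `w`, so its cone vanishes and `b` is the cone over its own
    -- boundary, hence over that of `g`.
    have hb' : b = g - simplicialBoundary k V (coneMap k w g) := by
      have h1 := boundary_coneMap_add w b
      rw [coneMap_eq_zero hb fun σ hσ => (ht σ hσ.1.1 hσ.2).1, map_zero, zero_add, ← hgb] at h1
      rw [← h1, eq_sub_iff_add_eq, add_comm, boundary_coneMap_add]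
    refine ⟨a + g, add_mem ha' (setChains_mono hls _ hg), ?_, -coneMap k w g, neg_mem ?_, ?_⟩
    · rw [map_add, hgb, hsum, add_neg_cancel]
    · refine coneMap_mem_supported hg fun σ hσ hwσ => ⟨hl σ hσ.1, ?_⟩
      rw [Finset.card_insert_of_notMem hwσ, hσ.2]
    · rw [map_neg, add_assoc, ← sub_eq_add_neg, ← hb']

/-- A cycle on `l` becomes a boundary once the cone over `l` is added. -/
theorem not_injective_setHomologyMap_of_cone {l s t : Set (Finset V)} (hls : l ⊆ s) (hst : s ⊆ t)
    (w : V) (hl : ∀ σ ∈ l, insert w σ ∈ t) (i : ℕ)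
    (hinj : Function.Injective (setHomologyMap k hls i)) [Nontrivial (setHomology k l i)] :
    ¬ Function.Injective (setHomologyMap k hst i) := by
  intro h
  obtain ⟨q, hq⟩ := exists_ne (0 : setHomology k l i)
  obtain ⟨⟨x, hx, hdx⟩, rfl⟩ := Submodule.Quotient.mk_surjective _ q
  refine hq ((Submodule.Quotient.mk_eq_zero _).mpr ?_)
  have hdx : simplicialBoundary k V x = 0 := hdx
  -- In `t` the cycle `x` bounds its cone. Two injective maps would make it bound in `s`, then in
  -- `l`.
  refine (homologyMap_injective_iff _ _ _).mp hinj x hx hdx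
    ((homologyMap_injective_iff _ _ _).mp h x (setChains_mono hls i hx) hdx
      ⟨coneMap k w x, ?_, ?_⟩)
  · refine coneMap_mem_supported hx fun σ hσ hwσ => ⟨hl σ hσ.1, ?_⟩
    rw [Finset.card_insert_of_notMem hwσ, hσ.2]
  · have h1 := boundary_coneMap_add w x
    rwa [hdx, map_zero, add_zero] at h1

theorem finite_setHomology {s : Set (Finset V)} (hs : s.Finite) (i : ℕ) :
    Module.Finite k (setHomology k s i) := by
  have hfin : Finite {σ | σ ∈ s ∧ σ.card = i} := (hs.subset fun σ hσ => hσ.1).to_subtype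
  have : Module.Finite k (setChains k s i) :=
    Module.Finite.equiv (Finsupp.supportedEquivFinsupp (M := k) (R := k)
      {σ | σ ∈ s ∧ σ.card = i}).symm
  have : Module.Finite k (cycles (setChains k s) (simplicialBoundary k V) i) :=
    Submodule.finiteDimensional_of_le (S₂ := setChains k s i) inf_le_left
  infer_instance

theorem finrank_lt_of_surjective_of_not_injective {E F : Type*} [AddCommGroup E] [Module k E] [Module.Finite k E]
    [AddCommGroup F] [Module k F] (f : E →ₗ[k] F)
    (hs : Function.Surjective f) (hi : ¬ Function.Injective f) :
    Module.finrank k F < Module.finrank k E := by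
  have : Module.Finite k F := Module.Finite.of_surjective f hs
  refine lt_of_le_of_ne (LinearMap.finrank_le_finrank_of_surjective hs) fun h => hi ?_
  exact (LinearMap.injective_iff_surjective_of_finrank_eq_finrank h.symm).mpr hs

end Sets

end VirtualSubdivision

namespace VirtualSubdivision

/-! ### Identifying a part of the homology with the homology of a smaller complex -/

section HomologyPart

universe u

variable {k R M N : Type*} [Field k] [CommRing R] [Algebra k R] [AddCommGroup M] [Module R M]
  [Module k M] [IsScalarTower k R M] [AddCommGroup N] [Module k N]
  (C : ℕ → Submodule R M) (d : M →ₗ[R] M) (D : ℕ → Submodule k N) (e : N →ₗ[k] N)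

/-- The map from cycles to homology classes induced by a map of complexes. -/
def homologyClassMap (φ : N →ₗ[k] M) (hφC : ∀ i, ∀ x ∈ D i, φ x ∈ C i)
    (hφd : ∀ i, ∀ x ∈ D i, d (φ x) = φ (e x)) (i : ℕ) : cycles D e i →ₗ[k] Homology C d i where
  toFun x := Submodule.Quotient.mk ⟨φ x, hφC i x x.2.1, LinearMap.mem_ker.mpr <| by
    rw [hφd i x x.2.1, show e x = 0 from x.2.2, map_zero]⟩
  map_add' x y := congrArg Submodule.Quotient.mk (Subtype.ext (map_add φ _ _))
  map_smul' a x := congrArg Submodule.Quotient.mk (Subtype.ext (map_smul φ a _))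

/-- If a complex is identified with the part `P` of another one by maps `φ` and `ψ`, then its
homology is identified with the part `P` of the homology. -/
theorem rank_homologyPart {k R : Type*} {M N : Type u} [Field k] [CommRing R] [Algebra k R]
    [AddCommGroup M] [Module R M]
    [Module k M] [IsScalarTower k R M] [AddCommGroup N] [Module k N]
    (C : ℕ → Submodule R M) (d : M →ₗ[R] M) (D : ℕ → Submodule k N) (e : N →ₗ[k] N)
    (P : Submodule k M) (φ : N →ₗ[k] M) (ψ : M →ₗ[k] N)
    (hφC : ∀ i, ∀ x ∈ D i, φ x ∈ C i) (hψD : ∀ i, ∀ y ∈ C i, ψ y ∈ D i)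
    (hφP : ∀ i, ∀ x ∈ D i, φ x ∈ P) (hψφ : ∀ i, ∀ x ∈ D i, ψ (φ x) = x)
    (hφψ : ∀ y ∈ P, φ (ψ y) = y) (hφd : ∀ i, ∀ x ∈ D i, d (φ x) = φ (e x))
    (hψd : ∀ i, ∀ y ∈ C i, e (ψ y) = ψ (d y)) (i : ℕ) :
    Module.rank k (homologyPart C d P i) = Module.rank k (Homology D e i) := by
  let f : Homology D e i →ₗ[k] Homology C d i :=
    Submodule.liftQ _ (homologyClassMap C d D e φ hφC hφd i) <| by
      rintro ⟨x, hx⟩ ⟨y, hy, hyx⟩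
      refine (Submodule.Quotient.mk_eq_zero _).mpr ⟨φ y, hφC _ y hy, ?_⟩
      exact (hφd _ y hy).trans (congrArg φ hyx)
  have hf : Function.Injective f := by
    rw [injective_iff_map_eq_zero]
    intro q hq
    obtain ⟨⟨x, hx⟩, rfl⟩ := Submodule.Quotient.mk_surjective _ q
    obtain ⟨y, hy, hyx⟩ := (Submodule.Quotient.mk_eq_zero _).mp hq
    -- The bounding chain `y` need not lie in `P`; this is why `ψ` must commute with the
    -- differentials on all of `C`.
    refine (Submodule.Quotient.mk_eq_zero _).mpr ⟨ψ y, hψD _ y hy, ?_⟩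
    exact (hψd _ y hy).trans ((congrArg ψ hyx).trans (hψφ _ x hx.1))
  have hrange : LinearMap.range f = homologyPart C d P i := by
    apply le_antisymm
    · rintro _ ⟨q, rfl⟩
      obtain ⟨⟨x, hx⟩, rfl⟩ := Submodule.Quotient.mk_surjective _ q
      exact ⟨⟨φ x, hφC i x hx.1, LinearMap.mem_ker.mpr
        ((hφd i x hx.1).trans ((congrArg φ hx.2).trans (map_zero φ)))⟩, hφP i x hx.1, rfl⟩
    · rintro _ ⟨⟨y, hy⟩, hyP, rfl⟩
      refine ⟨Submodule.Quotient.mk ⟨ψ y, hψD i y hy.1, LinearMap.mem_ker.mpr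
        ((hψd i y hy.1).trans ((congrArg ψ hy.2).trans (map_zero ψ)))⟩, ?_⟩
      exact congrArg Submodule.Quotient.mk (Subtype.ext (hφψ y hyP))
  rw [← hrange]
  exact (LinearEquiv.ofInjective f hf).rank_eq.symm

end HomologyPart

/-! ### Fine-graded pieces as simplicial chains -/

section Graded

theorem eq_of_eq_on_singles {R ι M N : Type*} [Semiring R] [AddCommMonoid M] [Module R M]
    [AddCommMonoid N] [Module R N] (f g : (ι →₀ M) →ₗ[R] N) {x : ι →₀ M}
    (h : ∀ i ∈ x.support, f (Finsupp.single i (x i)) = g (Finsupp.single i (x i))) :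
    f x = g x := by
  have hx : x = ∑ i ∈ x.support, Finsupp.single i (x i) := x.sum_single.symm
  rw [hx, map_sum, map_sum]
  exact Finset.sum_congr rfl h

theorem LComplex.mem_sub {V : Type*} {n : ℕ} {Δ : LComplex V n} {m : Fin n →₀ ℕ} {σ : Finset V} :
    σ ∈ (Δ.sub m).faces ↔ σ ∈ Δ.faces ∧ Δ.label σ ≤ m := by
  simp [LComplex.sub]

theorem toDeg_injective {n : ℕ} : Function.Injective (toDeg (n := n)) := by
  intro a b h
  ext ρ
  exact Nat.cast_injective (R := ℤ) (congrFun h ρ)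

theorem toDeg_add {n : ℕ} (a b : Fin n →₀ ℕ) : toDeg (a + b) = toDeg a + toDeg b := by
  funext ρ
  simp [toDeg]

variable (k : Type*) [Field k] {V : Type*} {n : ℕ}

/-- The map from simplicial chains to the elements of degree `m` of the free module,
`[σ] ↦ (m / ℓ(σ)) [σ]`. -/
noncomputable def homogenize (Δ : LComplex V n) (m : Fin n →₀ ℕ) :
    (Finset V →₀ k) →ₗ[k] (Finset V →₀ Cox k n) :=
  Finsupp.lsum k fun σ => (Finsupp.lsingle σ : Cox k n →ₗ[k] _) ∘ₗ monomial (m - Δ.label σ)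

open Classical in
/-- The coefficients of the component of degree `m` of an element of the free module. -/
noncomputable def dehomogenize (Δ : LComplex V n) (m : Fin n →₀ ℕ) :
    (Finset V →₀ Cox k n) →ₗ[k] (Finset V →₀ k) :=
  Finsupp.lsum k fun σ =>
    if Δ.label σ ≤ m then (Finsupp.lsingle σ : k →ₗ[k] _) ∘ₗ lcoeff k (m - Δ.label σ) else 0

variable {k} {Δ : LComplex V n} {m : Fin n →₀ ℕ}

theorem homogenize_single (σ : Finset V) (a : k) :
    homogenize k Δ m (Finsupp.single σ a) = Finsupp.single σ (monomial (m - Δ.label σ) a) := by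
  simp [homogenize]

theorem dehomogenize_single {σ : Finset V} (h : Δ.label σ ≤ m) (p : Cox k n) :
    dehomogenize k Δ m (Finsupp.single σ p) = Finsupp.single σ (coeff (m - Δ.label σ) p) := by
  simp [dehomogenize, h]

theorem dehomogenize_single_of_not_le {σ : Finset V} (h : ¬ Δ.label σ ≤ m) (p : Cox k n) :
    dehomogenize k Δ m (Finsupp.single σ p) = 0 := by
  simp [dehomogenize, h]

theorem dehomogenize_homogenize {i : ℕ} {x : Finset V →₀ k} (hx : x ∈ chains k (Δ.sub m) i) :
    dehomogenize k Δ m (homogenize k Δ m x) = x := by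
  refine eq_of_eq_on_singles (dehomogenize k Δ m ∘ₗ homogenize k Δ m) LinearMap.id fun σ hσ => ?_
  have h := (LComplex.mem_sub.mp (hx hσ).1).2
  simp [homogenize_single, dehomogenize_single h]

theorem homogenize_dehomogenize {f : Finset V →₀ Cox k n} (hf : f ∈ gradedPart k Δ (toDeg m)) :
    homogenize k Δ m (dehomogenize k Δ m f) = f := by
  refine eq_of_eq_on_singles (homogenize k Δ m ∘ₗ dehomogenize k Δ m) LinearMap.id fun σ hσ => ?_
  have hdeg : ∀ e ∈ (f σ).support, e + Δ.label σ = m := fun e he =>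
    toDeg_injective ((toDeg_add _ _).trans (hf σ e he))
  -- A monomial of a non-zero coefficient witnesses that `ℓ(σ)` divides `m`, which excludes the zero
  -- branch of `dehomogenize`.
  obtain ⟨e, he⟩ := Finset.nonempty_iff_ne_empty.mpr
    (mt support_eq_empty.mp (Finsupp.mem_support_iff.mp hσ))
  have hle : Δ.label σ ≤ m := hdeg e he ▸ le_add_self
  rw [LinearMap.comp_apply, dehomogenize_single hle, homogenize_single, LinearMap.id_apply]
  congr 1
  ext e'
  rw [coeff_monomial]
  split_ifs with h
  · rw [h]
  · by_contra hne
    have := hdeg e' (mem_support_iff.mpr fun h0 => hne h0.symm)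
    exact h (by rw [← this, add_tsub_cancel_right])

theorem homogenize_mem_gradedPart {i : ℕ} {x : Finset V →₀ k} (hx : x ∈ chains k (Δ.sub m) i) :
    homogenize k Δ m x ∈ gradedPart k Δ (toDeg m) := by
  rw [homogenize, Finsupp.lsum_apply]
  refine Submodule.sum_mem _ fun σ hσ τ e he => ?_
  have h := (LComplex.mem_sub.mp (hx hσ).1).2
  by_cases hτ : σ = τ
  · subst hτ
    simp only [LinearMap.comp_apply, Finsupp.lsingle_apply, Finsupp.single_eq_same] at he
    rw [Finset.mem_singleton.mp (support_monomial_subset he), ← toDeg_add, tsub_add_cancel_of_le h]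
  · simp [hτ] at he

theorem homogenize_mem_chains {i : ℕ} {x : Finset V →₀ k} (hx : x ∈ chains k (Δ.sub m) i) :
    homogenize k Δ m x ∈ chains (Cox k n) Δ.toSComplex i := by
  rw [homogenize, Finsupp.lsum_apply]
  exact Submodule.sum_mem _ fun σ hσ => Finsupp.single_mem_supported _ _
    ⟨(LComplex.mem_sub.mp (hx hσ).1).1, (hx hσ).2⟩

theorem dehomogenize_mem_chains {i : ℕ} {f : Finset V →₀ Cox k n}
    (hf : f ∈ chains (Cox k n) Δ.toSComplex i) :
    dehomogenize k Δ m f ∈ chains k (Δ.sub m) i := by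
  rw [dehomogenize, Finsupp.lsum_apply]
  refine Submodule.sum_mem _ fun σ hσ => ?_
  dsimp only
  split_ifs with h
  · exact Finsupp.single_mem_supported _ _ ⟨LComplex.mem_sub.mpr ⟨(hf hσ).1, h⟩, (hf hσ).2⟩
  · exact Submodule.zero_mem _

variable [LinearOrder V] {Δ : LComplex V n}

/-- The coefficients telescope: `(m / ℓ(σ)) (ℓ(σ) / ℓ(τ)) = m / ℓ(τ)`. The truncated subtractions of
exponents are exact because `ℓ(τ) ∣ ℓ(σ) ∣ m`. -/
theorem boundary_homogenize {i : ℕ} {x : Finset V →₀ k} (hx : x ∈ chains k (Δ.sub m) i) :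
    boundary (labelQuot k Δ) (homogenize k Δ m x) =
      homogenize k Δ m (simplicialBoundary k V x) := by
  refine eq_of_eq_on_singles ((boundary (labelQuot k Δ)).restrictScalars k ∘ₗ homogenize k Δ m)
    (homogenize k Δ m ∘ₗ simplicialBoundary k V) fun σ hσ => ?_
  obtain ⟨h1, h2⟩ := LComplex.mem_sub.mp (hx hσ).1
  simp only [LinearMap.comp_apply, LinearMap.restrictScalars_apply]
  rw [homogenize_single, boundary_single, boundary_single, map_sum]
  refine Finset.sum_congr rfl fun v hv => ?_
  have h3 := Δ.label_mono σ h1 _ (σ.erase_subset v)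
  rw [homogenize_single, labelQuot, mul_one, mul_left_comm, monomial_mul,
    tsub_add_tsub_cancel h2 h3, mul_one, mul_comm (x σ)]
  congr 1
  rcases neg_one_pow_eq_or k (position σ v) with h | h <;>
    rcases Nat.even_or_odd (position σ v) with h' | h' <;>
    simp [h'.neg_one_pow]

theorem boundary_dehomogenize {i : ℕ} {f : Finset V →₀ Cox k n}
    (hf : f ∈ chains (Cox k n) Δ.toSComplex i) :
    simplicialBoundary k V (dehomogenize k Δ m f) =
      dehomogenize k Δ m (boundary (labelQuot k Δ) f) := by
  refine eq_of_eq_on_singles (simplicialBoundary k V ∘ₗ dehomogenize k Δ m)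
    (dehomogenize k Δ m ∘ₗ (boundary (labelQuot k Δ)).restrictScalars k) fun σ hσ => ?_
  have h1 : σ ∈ Δ.faces := (hf hσ).1
  simp only [LinearMap.comp_apply, LinearMap.restrictScalars_apply]
  rw [boundary_single, map_sum]
  by_cases h2 : Δ.label σ ≤ m
  · rw [dehomogenize_single h2, boundary_single]
    refine Finset.sum_congr rfl fun v hv => ?_
    have h3 := Δ.label_mono σ h1 _ (σ.erase_subset v)
    rw [dehomogenize_single (h3.trans h2), labelQuot, mul_left_comm, mul_comm (f σ), mul_one]
    congr 1
    have h4 : coeff (m - Δ.label (σ.erase v))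
        (monomial (Δ.label σ - Δ.label (σ.erase v)) (1 : k) * f σ) =
          coeff (m - Δ.label σ) (f σ) := by
      rw [← tsub_add_tsub_cancel h2 h3, add_comm, coeff_monomial_mul, one_mul]
    rcases Nat.even_or_odd (position σ v) with h' | h' <;>
      simp [h'.neg_one_pow, h4]
  · rw [dehomogenize_single_of_not_le h2, map_zero, Finset.sum_eq_zero]
    intro v hv
    have h3 := Δ.label_mono σ h1 _ (σ.erase_subset v)
    by_cases h4 : Δ.label (σ.erase v) ≤ m
    · have h5 : ¬ Δ.label σ - Δ.label (σ.erase v) ≤ m - Δ.label (σ.erase v) := fun h =>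
        h2 ((tsub_le_tsub_iff_right h4).mp h)
      rw [dehomogenize_single h4, labelQuot, mul_left_comm, mul_comm (f σ)]
      rcases Nat.even_or_odd (position σ v) with h' | h' <;>
        simp [h'.neg_one_pow, coeff_monomial_mul', h5]
    · exact dehomogenize_single_of_not_le h4 _

variable (k Δ m)

/-- The part of degree `m` of the homology of `F_Δ` is the reduced homology of `Δ_m`. -/
theorem rank_freeHomologyDeg (i : ℕ) :
    Module.rank k (freeHomologyDeg k Δ i (toDeg m)) = Module.rank k (redHomology k (Δ.sub m) i) :=
  rank_homologyPart _ _ _ _ _ (homogenize k Δ m) (dehomogenize k Δ m)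
    (fun _ _ => homogenize_mem_chains) (fun _ _ => dehomogenize_mem_chains)
    (fun _ _ => homogenize_mem_gradedPart) (fun _ _ => dehomogenize_homogenize)
    (fun _ => homogenize_dehomogenize) (fun _ _ => boundary_homogenize)
    (fun _ _ => boundary_dehomogenize) i

/-- Labels and monomials have non-negative exponents, so the free module itself has no non-zero
element of such a degree. -/
theorem freeHomologyDeg_eq_bot {α : Fin n → ℤ} (hα : ∀ m, toDeg m ≠ α) (i : ℕ) :
    freeHomologyDeg k Δ i α = ⊥ := by
  rw [eq_bot_iff]
  rintro _ ⟨⟨f, hf⟩, hfdeg, rfl⟩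
  have hf0 : f = 0 := by
    ext σ e
    by_contra hne
    exact hα (e + Δ.label σ) ((toDeg_add _ _).trans (hfdeg σ e (mem_support_iff.mpr hne)))
  subst hf0
  exact (Submodule.Quotient.mk_eq_zero _).mpr (Submodule.zero_mem _)

end Graded

/-! ### Comparing `Δ_m` and `Δ'_m` -/

section Subdivision

variable {V : Type*} {n : ℕ} {m : Fin n →₀ ℕ}

/-- By recursion every label is the lcm of the vertex labels, so `Δ_m` is the full subcomplex on the
vertices whose labels divide `m`. -/
theorem LComplex.IsLcm.label_le_iff [DecidableEq V] {Δ : LComplex V n} (hΔ : Δ.IsLcm)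
    {σ : Finset V} (hσ : σ ∈ Δ.faces) : Δ.label σ ≤ m ↔ ∀ v ∈ σ, Δ.label {v} ≤ m := by
  refine ⟨fun h v hv => (Δ.label_mono σ hσ _ (Finset.singleton_subset_iff.mpr hv)).trans h, ?_⟩
  induction σ using Finset.strongInduction with
  | H σ ih =>
    intro h
    rcases lt_or_ge σ.card 2 with hc | hc
    · rcases (Nat.lt_succ_iff.mp hc).lt_or_eq with h0 | h1
      · obtain rfl := Finset.card_eq_zero.mp (Nat.lt_one_iff.mp h0)
        rw [hΔ.1 hσ]
        exact zero_le
      · obtain ⟨v, rfl⟩ := Finset.card_eq_one.mp h1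
        exact h v (Finset.mem_singleton_self v)
    · rw [hΔ.2 σ hσ hc]
      refine Finset.sup_le fun τ hτ => ?_
      have hτσ := Finset.mem_ssubsets.mp hτ
      exact ih τ hτσ (Δ.down_closed σ hσ τ hτσ.subset) fun v hv => h v (hτσ.subset hv)

variable [LinearOrder V] {Δ Δ' : LComplex V n} {ω : Finset V} {v' : V}

theorem IsSubdivision.mem_faces (h : IsSubdivision Δ Δ' ω v') {σ : Finset V} :
    σ ∈ Δ'.faces ↔ (σ ∈ Δ.faces ∧ ¬ ω ⊆ σ) ∨
      ∃ τ ∈ Δ.faces, τ ∪ ω ∈ Δ.faces ∧ ¬ ω ⊆ τ ∧ σ = insert v' τ := by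
  rw [h.eq]
  simp only [SComplex.subdivide, Finset.mem_union, Finset.mem_filter, Finset.mem_image]
  refine or_congr Iff.rfl ⟨?_, ?_⟩
  · rintro ⟨τ, ⟨h1, h2, h3⟩, rfl⟩
    exact ⟨τ, h1, h2, h3, by rw [Finset.union_comm, ← Finset.insert_eq]⟩
  · rintro ⟨τ, h1, h2, h3, rfl⟩
    exact ⟨τ, ⟨h1, h2, h3⟩, by rw [Finset.union_comm, ← Finset.insert_eq]⟩

theorem IsSubdivision.notMem (h : IsSubdivision Δ Δ' ω v') {σ : Finset V} (hσ : σ ∈ Δ.faces) :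
    v' ∉ σ := fun hv =>
  h.new (Δ.down_closed σ hσ _ (Finset.singleton_subset_iff.mpr hv))

theorem IsSubdivision.label_eq_of_not_subset (h : IsSubdivision Δ Δ' ω v') {σ : Finset V}
    (hσ : σ ∈ Δ.faces) (hω : ¬ ω ⊆ σ) : Δ'.label σ = Δ.label σ :=
  h.label_eq σ hσ (h.mem_faces.mpr (Or.inl ⟨hσ, hω⟩))

/-- The added simplices contain `v'` and the removed ones contain `ω`; as `ℓ'(v') ∣ ℓ(ω)`, the
labels of both kinds fail to divide `m`. -/
theorem IsSubdivision.mem_sub_of_not_le (h : IsSubdivision Δ Δ' ω v')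
    (hdvd : Δ'.label {v'} ≤ Δ.label ω) (hm : ¬ Δ'.label {v'} ≤ m) {σ : Finset V} :
    σ ∈ (Δ'.sub m).faces ↔ σ ∈ (Δ.sub m).faces := by
  rw [LComplex.mem_sub, LComplex.mem_sub]
  constructor
  · rintro ⟨hσ, hle⟩
    rcases h.mem_faces.mp hσ with ⟨h1, h2⟩ | ⟨τ, -, -, -, rfl⟩
    · exact ⟨h1, h.label_eq_of_not_subset h1 h2 ▸ hle⟩
    · exact absurd ((Δ'.label_mono _ hσ _ (by simp)).trans hle) hm
  · rintro ⟨hσ, hle⟩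
    have hω : ¬ ω ⊆ σ := fun hω => hm (hdvd.trans ((Δ.label_mono σ hσ ω hω).trans hle))
    exact ⟨h.mem_faces.mpr (Or.inl ⟨hσ, hω⟩), (h.label_eq_of_not_subset hσ hω).symm ▸ hle⟩

/-- Joining with `v'` does not affect whether an lcm label divides `m`. The condition on `τ ∪ ω`
stays in `Δ`, since `ω` need not belong to `Δ_m`. -/
theorem IsSubdivision.mem_sub_iff (h : IsSubdivision Δ Δ' ω v') (hΔ' : Δ'.IsLcm)
    (hm : Δ'.label {v'} ≤ m) {σ : Finset V} :
    σ ∈ (Δ'.sub m).faces ↔ (σ ∈ (Δ.sub m).faces ∧ ¬ ω ⊆ σ) ∨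
      ∃ τ ∈ (Δ.sub m).faces, τ ∪ ω ∈ Δ.faces ∧ ¬ ω ⊆ τ ∧ σ = insert v' τ := by
  simp only [LComplex.mem_sub]
  constructor
  · rintro ⟨hσ, hle⟩
    rcases h.mem_faces.mp hσ with ⟨h1, h2⟩ | ⟨τ, h1, h2, h3, rfl⟩
    · exact Or.inl ⟨⟨h1, h.label_eq_of_not_subset h1 h2 ▸ hle⟩, h2⟩
    · refine Or.inr ⟨τ, ⟨h1, ?_⟩, h2, h3, rfl⟩
      rw [← h.label_eq_of_not_subset h1 h3]
      exact (Δ'.label_mono _ hσ _ (Finset.subset_insert _ _)).trans hle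
  · rintro (⟨⟨h1, hle⟩, h2⟩ | ⟨τ, ⟨h1, hle⟩, h2, h3, rfl⟩)
    · exact ⟨h.mem_faces.mpr (Or.inl ⟨h1, h2⟩), (h.label_eq_of_not_subset h1 h2).symm ▸ hle⟩
    · have hσ := h.mem_faces.mpr (Or.inr ⟨τ, h1, h2, h3, rfl⟩)
      refine ⟨hσ, (hΔ'.label_le_iff hσ).mpr ?_⟩
      rw [← h.label_eq_of_not_subset h1 h3,
        hΔ'.label_le_iff (h.mem_faces.mpr (Or.inl ⟨h1, h3⟩))] at hle
      exact Finset.forall_mem_insert _ _ _ |>.mpr ⟨hm, hle⟩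

variable (k : Type*) [Field k]

theorem IsSubdivision.rank_redHomology_of_not_le (h : IsSubdivision Δ Δ' ω v')
    (hdvd : Δ'.label {v'} ≤ Δ.label ω) (hm : ¬ Δ'.label {v'} ≤ m) (i : ℕ) :
    Module.rank k (redHomology k (Δ'.sub m) i) = Module.rank k (redHomology k (Δ.sub m) i) := by
  change Module.rank k (setHomology k {σ | σ ∈ (Δ'.sub m).faces} i) =
    Module.rank k (setHomology k {σ | σ ∈ (Δ.sub m).faces} i)
  have hset : {σ | σ ∈ (Δ'.sub m).faces} = {σ | σ ∈ (Δ.sub m).faces} :=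
    Set.ext fun σ => h.mem_sub_of_not_le hdvd hm
  rw [hset]

/-- If the label of a vertex of `ω` divides `m`, then `Δ_m` and `Δ'_m` have the same homology:
both are retracts of the union of `Δ_m` and the cone over the star of `ω` in `Δ_m`. -/
theorem IsSubdivision.rank_redHomology_of_le (h : IsSubdivision Δ Δ' ω v') (hΔ : Δ.IsLcm)
    (hΔ' : Δ'.IsLcm) (hm : Δ'.label {v'} ≤ m) {w : V} (hw : w ∈ ω) (hwm : Δ.label {w} ≤ m)
    (i : ℕ) :
    Module.rank k (redHomology k (Δ'.sub m) i) = Module.rank k (redHomology k (Δ.sub m) i) := by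
  set s : Set (Finset V) := {σ | σ ∈ (Δ.sub m).faces} with hs
  set s' : Set (Finset V) := {σ | σ ∈ (Δ'.sub m).faces} with hs'
  set t : Set (Finset V) :=
    {σ | σ ∈ s ∨ ∃ τ ∈ s, τ ∪ ω ∈ Δ.faces ∧ σ = insert v' τ} with ht
  have hmem : ∀ {σ}, σ ∈ s' ↔ (σ ∈ s ∧ ¬ ω ⊆ σ) ∨
      ∃ τ ∈ s, τ ∪ ω ∈ Δ.faces ∧ ¬ ω ⊆ τ ∧ σ = insert v' τ := h.mem_sub_iff hΔ' hm
  have hv' : ∀ {σ}, σ ∈ s → v' ∉ σ := fun hσ => h.notMem (LComplex.mem_sub.mp hσ).1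
  -- The star of `ω` within `Δ_m` is itself a cone with apex `w`.
  have hstar : ∀ {τ}, τ ∈ s → τ ∪ ω ∈ Δ.faces →
      insert w τ ∈ s ∧ insert w τ ∪ ω ∈ Δ.faces := by
    intro τ hτ hτω
    obtain ⟨h1, h2⟩ := LComplex.mem_sub.mp hτ
    have h3 : insert w τ ∈ Δ.faces := Δ.down_closed _ hτω _
      (Finset.insert_subset (Finset.mem_union_right _ hw) Finset.subset_union_left)
    refine ⟨LComplex.mem_sub.mpr ⟨h3, (hΔ.label_le_iff h3).mpr ?_⟩, ?_⟩
    · exact Finset.forall_mem_insert _ _ _ |>.mpr ⟨hwm, (hΔ.label_le_iff h1).mp h2⟩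
    · rwa [Finset.insert_union, Finset.insert_eq_self.mpr (Finset.mem_union_right _ hw)]
  -- The simplices outside `s` are the joins of `v'` with the star, and adding or removing `w` pairs
  -- them.
  have e1 : Module.rank k (setHomology k s i) = Module.rank k (setHomology k t i) := by
    refine rank_setHomology_eq (fun σ hσ => Or.inl hσ) w
      (fun σ hσ v _ => (Δ.sub m).down_closed σ hσ _ (σ.erase_subset v)) ?_ ?_ i
    · rintro σ (hσ | ⟨τ, h1, h2, rfl⟩) hσs
      · exact absurd hσ hσs
      · exact Or.inr ⟨insert w τ, (hstar h1 h2).1, (hstar h1 h2).2, Finset.insert_comm _ _ _⟩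
    · rintro σ (hσ | ⟨τ, h1, h2, rfl⟩) hσs v hv hvs
      · exact absurd hσ hσs
      · have hvv : v = v' := by
          by_contra hne
          exact hv' hvs (Finset.mem_erase.mpr ⟨Ne.symm hne, Finset.mem_insert_self _ _⟩)
        subst hvv
        rw [Finset.erase_insert (hv' h1)]
        exact (hstar h1 h2).1
  -- The simplices outside `s'` contain `ω`, and adding or removing `v'` pairs them.
  have e2 : Module.rank k (setHomology k s' i) = Module.rank k (setHomology k t i) := by
    refine rank_setHomology_eq ?_ v'
      (fun σ hσ v _ => (Δ'.sub m).down_closed σ hσ _ (σ.erase_subset v)) ?_ ?_ i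
    · intro σ hσ
      rcases hmem.mp hσ with ⟨h1, -⟩ | ⟨τ, h1, h2, -, h3⟩
      · exact Or.inl h1
      · exact Or.inr ⟨τ, h1, h2, h3⟩
    · rintro σ (hσ | ⟨τ, h1, h2, rfl⟩) hσs
      · have hω : ω ⊆ σ := by
          by_contra hω
          exact hσs (hmem.mpr (Or.inl ⟨hσ, hω⟩))
        refine Or.inr ⟨σ, hσ, ?_, rfl⟩
        rw [Finset.union_eq_left.mpr hω]
        exact (LComplex.mem_sub.mp hσ).1
      · rw [Finset.insert_idem]
        exact Or.inr ⟨τ, h1, h2, rfl⟩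
    · rintro σ hσt hσs v hv hvs
      by_cases hv'' : v' ∈ σ.erase v
      · rwa [Finset.insert_eq_self.mpr hv'']
      have hω' : ¬ ω ⊆ σ.erase v ∧ σ.erase v ∈ s := by
        rcases hmem.mp hvs with ⟨h1, h2⟩ | ⟨τ, -, -, -, h3⟩
        · exact ⟨h2, h1⟩
        · exact absurd (h3 ▸ Finset.mem_insert_self _ _) hv''
      rcases hσt with hσ | ⟨τ, h1, h2, rfl⟩
      · have hω : ω ⊆ σ := by
          by_contra hω
          exact hσs (hmem.mpr (Or.inl ⟨hσ, hω⟩))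
        exact hmem.mpr (Or.inr ⟨_, hω'.2, Δ.down_closed σ (LComplex.mem_sub.mp hσ).1 _
          (Finset.union_subset (σ.erase_subset v) hω), hω'.1, rfl⟩)
      · have hvv : v = v' := by
          by_contra hne
          exact hv'' (Finset.mem_erase.mpr ⟨Ne.symm hne, Finset.mem_insert_self _ _⟩)
        subst hvv
        rw [Finset.erase_insert (hv' h1)] at hω'
        exact absurd (hmem.mpr (Or.inr ⟨τ, h1, h2, hω'.1, rfl⟩)) hσs
  exact e2.trans e1.symm

/-- If no vertex label of `ω` divides `m`, then `Δ'_m` is `Δ_m` with a cone over `Γ_m` added, where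
`Γ` is the link of `ω`. -/
theorem IsSubdivision.finrank_redHomology_of_forall_not_le (h : IsSubdivision Δ Δ' ω v')
    (hΔ' : Δ'.IsLcm) (hm : Δ'.label {v'} ≤ m) (hω : ∀ v ∈ ω, ¬ Δ.label {v} ≤ m)
    (hinj : ∀ j : ℕ, Function.Injective (redHomologyMap k (link_sub_subset Δ ω m) j)) (i : ℕ) :
    Module.finrank k (redHomology k (Δ'.sub m) i) ≤ Module.finrank k (redHomology k (Δ.sub m) i) ∧
    (Nontrivial (redHomology k ((Δ.link ω).sub m) i) →
      Module.finrank k (redHomology k (Δ'.sub m) i) <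
        Module.finrank k (redHomology k (Δ.sub m) i)) := by
  set l : Set (Finset V) := {σ | σ ∈ ((Δ.link ω).sub m).faces} with hl
  set s : Set (Finset V) := {σ | σ ∈ (Δ.sub m).faces} with hs
  set t : Set (Finset V) := {σ | σ ∈ (Δ'.sub m).faces} with ht
  have hdisj : ∀ {σ}, σ ∈ s → Disjoint ω σ := by
    intro σ hσ
    obtain ⟨h1, h2⟩ := LComplex.mem_sub.mp hσ
    exact Finset.disjoint_left.mpr fun v hv hvσ => hω v hv
      ((Δ.label_mono σ h1 _ (Finset.singleton_subset_iff.mpr hvσ)).trans h2)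
  have hnot : ∀ {σ}, σ ∈ s → ¬ ω ⊆ σ := by
    intro σ hσ hsub
    obtain ⟨v, hv⟩ := h.nonempty
    exact Finset.disjoint_left.mp (hdisj hσ) hv (hsub hv)
  have hmem : ∀ {σ}, σ ∈ t ↔ (σ ∈ s ∧ ¬ ω ⊆ σ) ∨
      ∃ τ ∈ s, τ ∪ ω ∈ Δ.faces ∧ ¬ ω ⊆ τ ∧ σ = insert v' τ := h.mem_sub_iff hΔ' hm
  have hls : l ⊆ s := link_sub_subset Δ ω m
  have hst : s ⊆ t := fun σ hσ => hmem.mpr (Or.inl ⟨hσ, hnot hσ⟩)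
  -- Simplices of `Δ_m` avoid all vertices of `ω`, so the disjointness in the link is automatic and
  -- the cone attached in `Δ'_m` is exactly the one over `Γ_m`.
  have hmeml : ∀ {σ}, σ ∈ l ↔ σ ∈ s ∧ σ ∪ ω ∈ Δ.faces := by
    intro σ
    have : σ ∈ (Δ.link ω).faces ↔ σ ∈ Δ.faces ∧ Disjoint ω σ ∧ ω ∪ σ ∈ Δ.faces :=
      Finset.mem_filter
    constructor
    · intro hσ
      refine ⟨hls hσ, ?_⟩
      rw [Finset.union_comm]
      exact (this.mp (LComplex.mem_sub.mp hσ).1).2.2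
    · rintro ⟨h1, h2⟩
      rw [Finset.union_comm] at h2
      obtain ⟨h3, h4⟩ := LComplex.mem_sub.mp h1
      exact LComplex.mem_sub.mpr ⟨this.mpr ⟨h3, hdisj h1, h2⟩, h4⟩
  have hlt : ∀ σ ∈ l, insert v' σ ∈ t := fun σ hσ =>
    hmem.mpr (Or.inr ⟨σ, hls hσ, (hmeml.mp hσ).2, hnot (hls hσ), rfl⟩)
  have hv' : ∀ σ ∈ s, v' ∉ σ := fun σ hσ => h.notMem (LComplex.mem_sub.mp hσ).1
  have hsurj : Function.Surjective (setHomologyMap k hst i) := by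
    refine setHomologyMap_surjective_of_cone hls hst v' hv'
      (fun σ hσ v _ => (Δ.sub m).down_closed σ hσ _ (σ.erase_subset v)) hlt ?_ hinj i
    intro σ hσ hσs
    rcases hmem.mp hσ with ⟨h1, -⟩ | ⟨τ, h1, h2, -, rfl⟩
    · exact absurd h1 hσs
    · refine ⟨Finset.mem_insert_self _ _, ?_⟩
      rw [Finset.erase_insert (hv' _ h1)]
      exact hmeml.mpr ⟨h1, h2⟩
  have hfin : Module.Finite k (setHomology k s i) :=
    finite_setHomology (Finset.finite_toSet (Δ.sub m).faces) i
  change Module.finrank k (setHomology k t i) ≤ Module.finrank k (setHomology k s i) ∧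
    (Nontrivial (setHomology k l i) →
      Module.finrank k (setHomology k t i) < Module.finrank k (setHomology k s i))
  refine ⟨LinearMap.finrank_le_finrank_of_surjective hsurj, fun hnt => ?_⟩
  exact finrank_lt_of_surjective_of_not_injective _ hsurj
    (not_injective_setHomologyMap_of_cone hls hst v' hlt i (hinj i))

theorem finite_redHomology (K : SComplex V) (i : ℕ) : Module.Finite k (redHomology k K i) :=
  finite_setHomology (Finset.finite_toSet K.faces) i

end Subdivision

end VirtualSubdivision

theorem theorem1p4 {k : Type*} [Field k] {r n : ℕ} (X : SmoothFan r n)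
    {V : Type*} [LinearOrder V] (Δ Δ' : LComplex V n) (ω : Finset V) (v' : V)
    (hΔ : Δ.IsLcm) (hvirt : IsVirtualResolution k X Δ) (hΔ' : Δ'.IsLcm)
    (hsub : IsVirtualCompatible k X Δ Δ' ω v')
    (hinj : ∀ m : Fin n →₀ ℕ, Δ'.label {v'} ≤ m → (∀ v ∈ ω, ¬ Δ.label {v} ≤ m) →
      ∀ j : ℕ, Function.Injective (redHomologyMap k (link_sub_subset Δ ω m) j)) :
    (∀ (i : ℕ) (α : Fin n → ℤ),
      Module.rank k (freeHomologyDeg k Δ' i α) ≤ Module.rank k (freeHomologyDeg k Δ i α)) ∧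
    (∀ (i : ℕ) (m : Fin n →₀ ℕ), Δ'.label {v'} ≤ m → (∀ v ∈ ω, ¬ Δ.label {v} ≤ m) →
      Nontrivial (redHomology k ((Δ.link ω).sub m) i) →
      Module.rank k (freeHomologyDeg k Δ' i (toDeg m)) <
        Module.rank k (freeHomologyDeg k Δ i (toDeg m))) := by
  have hs := hsub.toIsSubdivision
  refine ⟨fun i α => ?_, fun i m hm hω hnt => ?_⟩
  -- A degree with a negative entry comes from no monomial, and both sides vanish there.
  · by_cases hα : ∃ m, toDeg m = α
    · obtain ⟨m, rfl⟩ := hα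
      rw [rank_freeHomologyDeg, rank_freeHomologyDeg]
      by_cases hm : Δ'.label {v'} ≤ m
      · by_cases hω : ∃ w ∈ ω, Δ.label {w} ≤ m
        · obtain ⟨w, hw, hwm⟩ := hω
          exact (hs.rank_redHomology_of_le k hΔ hΔ' hm hw hwm i).le
        · push Not at hω
          have := finite_redHomology k (Δ.sub m) i
          have := finite_redHomology k (Δ'.sub m) i
          rw [← Module.finrank_eq_rank, ← Module.finrank_eq_rank, Nat.cast_le]
          exact (hs.finrank_redHomology_of_forall_not_le k hΔ' hm hω (hinj m hm hω) i).1
      · exact (hs.rank_redHomology_of_not_le k hsub.dvd hm i).le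
    · push Not at hα
      rw [freeHomologyDeg_eq_bot k Δ' hα, rank_bot]
      exact zero_le
  -- Finite dimension turns the cardinal ranks into natural numbers, where a surjection that is not
  -- injective lowers the dimension.
  · have := finite_redHomology k (Δ.sub m) i
    have := finite_redHomology k (Δ'.sub m) i
    rw [rank_freeHomologyDeg, rank_freeHomologyDeg, ← Module.finrank_eq_rank,
      ← Module.finrank_eq_rank, Nat.cast_lt]
    exact (hs.finrank_redHomology_of_forall_not_le k hΔ' hm hω (hinj m hm hω) i).2 hnt
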